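/- Let $W=(W^1,\dots,W^d)$ be a standard $d$-dimensional Brownian motion, let $0\le s<t$, and put $h:=t-s$. For $0\le a<b$ write $W_{a,b}:=W_b-W_a$ and define the (rescaled) space-time Lévy area $$H_{a,b}:=\frac1{b-a}\int_a^b\Big(W_{a,r}-\frac{r-a}{b-a}W_{a,b}\Big)\,dr .$$ The (rescaled) space-time-time Lévy area of $W$ over $[s,t]$ is $$K_{s,t}:=\frac1{h^2}\int_s^t\Big(W_{s,r}-\frac{r-s}{h}W_{s,t}\Big)\Big(\tfrac12h-(r-s)\Big)\,dr,$$ and the space-time Lévy swing of $W$ over $[s,t]$ is $n_{s,t}:=\operatorname{sgn}(H_{s,u}-H_{u,t})$, with $u:=\frac12(s+t)$ and $\operatorname{sgn}$ applied coordinatewise. Then $K_{s,t}$ is square-integrable and, almost surely, $$\mathbb E\big[K_{s,t}\,\big|\,n_{s,t}\big]=\frac1{8\sqrt{6\pi}}\,n_{s,t}\,h^{1/2},$$ and for every $i\in\{1,\dots,d\}$, almost surely, $$\operatorname{Var}\big(K^i_{s,t}\,\big|\,n_{s,t}\big)=\Big(\frac1{720}-\frac1{384\pi}\Big)h .$$ 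-/

import Mathlib

open MeasureTheory ProbabilityTheory
open scoped NNReal

/-- A standard `d`-dimensional Brownian motion on `(Ω, P)`: the coordinate processes are
independent, and each of them is a standard real Brownian motion (started at `0`, Gaussian
finite-dimensional laws with covariance `min s t`, almost surely continuous paths). -/
structure IsStandardBrownianMotion {Ω : Type*} [MeasurableSpace Ω] {d : ℕ}
    (W : ℝ≥0 → Ω → EuclideanSpace ℝ (Fin d)) (P : Measure Ω) : Prop where
  isBrownianReal : ∀ i : Fin d, IsBrownianReal (fun t ω => W t ω i) P
  iIndepFun_coord : iIndepFun (fun (i : Fin d) (ω : Ω) (t : ℝ≥0) => W t ω i) P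

/-- The value at `u ∈ [s, t]` of the Brownian bridge of `W` on `[s, t]`:
`W_{s,u} - ((u - s) / h) W_{s,t}`, where `h = t - s` and `W_{a,b} = W_b - W_a`. -/
noncomputable def bridgeOn {Ω : Type*} {d : ℕ} (W : ℝ≥0 → Ω → EuclideanSpace ℝ (Fin d))
    (s t : ℝ≥0) (u : ℝ) (ω : Ω) : EuclideanSpace ℝ (Fin d) :=
  (W u.toNNReal ω - W s ω) - ((u - s) / ((t : ℝ) - s)) • (W t ω - W s ω)

/-- The (rescaled) space-time Lévy area `H_{s,t}`. -/
noncomputable def spaceTimeArea {Ω : Type*} {d : ℕ} (W : ℝ≥0 → Ω → EuclideanSpace ℝ (Fin d))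
    (s t : ℝ≥0) (ω : Ω) : EuclideanSpace ℝ (Fin d) :=
  (1 / ((t : ℝ) - s)) • ∫ u in (s : ℝ)..t, bridgeOn W s t u ω

/-- The (rescaled) space-time-time Lévy area `K_{s,t}`. -/
noncomputable def spaceTimeTimeArea {Ω : Type*} {d : ℕ}
    (W : ℝ≥0 → Ω → EuclideanSpace ℝ (Fin d)) (s t : ℝ≥0) (ω : Ω) : EuclideanSpace ℝ (Fin d) :=
  (1 / ((t : ℝ) - s) ^ 2) •
    ∫ u in (s : ℝ)..t, (1 / 2 * ((t : ℝ) - s) - (u - s)) • bridgeOn W s t u ω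

/-- The space-time Lévy swing `n_{s,t} = sgn (H_{s,m} - H_{m,t})`, with `m` the midpoint of
`[s, t]` and `sgn` applied coordinatewise. -/
noncomputable def levySwing {Ω : Type*} {d : ℕ} (W : ℝ≥0 → Ω → EuclideanSpace ℝ (Fin d))
    (s t : ℝ≥0) (ω : Ω) : EuclideanSpace ℝ (Fin d) :=
  WithLp.toLp 2 fun i =>
    Real.sign (spaceTimeArea W s ((s + t) / 2) ω i - spaceTimeArea W ((s + t) / 2) t ω i)

/-! Fix a coordinate, let m be the midpoint of [s, t], h = t - s, x = (r - m)/h. Integration by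
parts turns K and D = H_{s,m} - H_{m,t} into Wiener integrals over [s, t], with kernels x²/2 - 1/24
and 2|x| - 1/2 (`spaceTimeTimeArea_apply`, `spaceTimeArea_sub_apply`). Their inner product is h/96
and the second has squared norm h/12, so subtracting 1/8 of the second from the first leaves an
orthogonal remainder. Hence K = R + D/8 almost surely, with R and D independent centred Gaussians of
variances (1/720 - 1/768)h and h/12.

A centred Gaussian has independent modulus and sign, so (R, |D|) is independent of sgn D and, the
coordinates being independent, of the whole swing n
(`indepFun_residualPart_abs_swingPart_levySwing`). Writing D = |D| sgn D gives E[K | n] = (1/8) E|D|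
n with E|D| = √(h/(6π)). Likewise E[K² | n] = E R² + E D²/64 = h/720, since the cross term vanishes,
and the squared conditional mean is h/(384π) (`condExp_condVar_add_mul_of_sign`).

Wiener integrals are handled pathwise: for continuous paths the integration-by-parts expression is
the limit of left-point sums, which gives Gaussian laws and measurability on path space. -/

/-! ### Riemann and Stieltjes sums on uniform partitions. -/

/-- The `m`-th node of the uniform partition of `[a, b]` into `n` pieces. -/
noncomputable def uniformNode (a b : ℝ) (n m : ℕ) : ℝ := a + m * ((b - a) / n)

lemma uniformNode_zero (a b : ℝ) (n : ℕ) : uniformNode a b n 0 = a := by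
  simp [uniformNode]

lemma uniformNode_self (a b : ℝ) {n : ℕ} (hn : n ≠ 0) : uniformNode a b n n = b := by
  simp only [uniformNode]; field_simp; ring

lemma uniformNode_succ_sub (a b : ℝ) (n m : ℕ) :
    uniformNode a b n (m + 1) - uniformNode a b n m = (b - a) / n := by
  simp only [uniformNode]; push_cast; ring

lemma uniformNode_mono {a b : ℝ} (hab : a ≤ b) (n : ℕ) : Monotone (uniformNode a b n) := by
  refine monotone_nat_of_le_succ fun m => ?_
  have h := uniformNode_succ_sub a b n m
  have : 0 ≤ (b - a) / n := div_nonneg (by linarith) (by positivity)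
  linarith

lemma left_le_uniformNode {a b : ℝ} (hab : a ≤ b) (n m : ℕ) : a ≤ uniformNode a b n m := by
  simpa [uniformNode_zero] using uniformNode_mono hab n (Nat.zero_le m)

lemma uniformNode_mem_Icc {a b : ℝ} (hab : a ≤ b) {n m : ℕ} (hn : n ≠ 0) (hm : m ≤ n) :
    uniformNode a b n m ∈ Set.Icc a b :=
  ⟨left_le_uniformNode hab n m, by
    simpa [uniformNode_self a b hn] using uniformNode_mono hab n hm⟩

lemma intervalIntegrable_between_nodes {a b : ℝ} (hab : a ≤ b) {f : ℝ → ℝ}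
    (hf : IntervalIntegrable f volume a b) {n m : ℕ} (hn : n ≠ 0) (hm : m < n) :
    IntervalIntegrable f volume (uniformNode a b n m) (uniformNode a b n (m + 1)) := by
  refine hf.mono_set ?_
  rw [Set.uIcc_of_le (uniformNode_mono hab n m.le_succ), Set.uIcc_of_le hab]
  exact Set.Icc_subset_Icc (uniformNode_mem_Icc hab hn hm.le).1 (uniformNode_mem_Icc hab hn hm).2

lemma sum_integral_uniformNode {a b : ℝ} (hab : a ≤ b) {f : ℝ → ℝ}
    (hf : IntervalIntegrable f volume a b) {n : ℕ} (hn : n ≠ 0) :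
    ∑ m ∈ Finset.range n, ∫ r in uniformNode a b n m..uniformNode a b n (m + 1), f r
      = ∫ r in a..b, f r := by
  rw [intervalIntegral.sum_integral_adjacent_intervals (a := uniformNode a b n)
    (fun k hk => intervalIntegrable_between_nodes hab hf hn hk), uniformNode_zero,
    uniformNode_self a b hn]

/-- Tagged Riemann sums of a continuous function against an integrable density converge. -/
lemma tendsto_sum_tag_mul_integral {a b : ℝ} (hab : a ≤ b) {f w : ℝ → ℝ}
    (hf : IntervalIntegrable f volume a b) (hw : Continuous w) (tag : ℕ → ℕ → ℝ)
    (htag : ∀ n m, tag n m ∈ Set.Icc (uniformNode a b n m) (uniformNode a b n (m + 1))) :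
    Filter.Tendsto (fun n : ℕ => ∑ m ∈ Finset.range n,
      w (tag n m) * ∫ r in uniformNode a b n m..uniformNode a b n (m + 1), f r)
      Filter.atTop (nhds (∫ r in a..b, w r * f r)) := by
  have hfw : IntervalIntegrable (fun r => w r * f r) volume a b :=
    hf.continuousOn_mul hw.continuousOn
  have hfa : IntervalIntegrable (fun r => |f r|) volume a b := hf.abs
  set J := ∫ r in a..b, |f r| with hJ
  have hJ0 : 0 ≤ J := intervalIntegral.integral_nonneg hab fun _ _ => abs_nonneg _
  rw [Metric.tendsto_atTop]
  intro ε hε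
  have huc := isCompact_Icc.uniformContinuousOn_of_continuous (hw.continuousOn (s := Set.Icc a b))
  rw [Metric.uniformContinuousOn_iff] at huc
  -- The error is at most (modulus of continuity of `w` at the mesh) · `J`; dividing by `J + 1`
  -- covers `J = 0` and makes the final bound strict.
  obtain ⟨δ, hδ, hδw⟩ := huc (ε / (J + 1)) (by positivity)
  obtain ⟨N, hN⟩ := exists_nat_gt ((b - a) / δ)
  refine ⟨N + 1, fun n hn => ?_⟩
  have hn0 : n ≠ 0 := by omega
  have hnpos : (0 : ℝ) < n := by positivity
  have hmesh : (b - a) / n < δ := by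
    rw [div_lt_iff₀ hnpos]
    rw [div_lt_iff₀ hδ] at hN
    have : (N : ℝ) ≤ n := by exact_mod_cast (by omega : N ≤ n)
    nlinarith
  rw [Real.dist_eq, ← sum_integral_uniformNode hab hfw hn0, ← Finset.sum_sub_distrib]
  calc _ ≤ ∑ m ∈ Finset.range n, |w (tag n m) *
        (∫ r in uniformNode a b n m..uniformNode a b n (m + 1), f r) -
        ∫ r in uniformNode a b n m..uniformNode a b n (m + 1), w r * f r| :=
        Finset.abs_sum_le_sum_abs _ _
    _ ≤ ∑ m ∈ Finset.range n, ε / (J + 1) *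
        ∫ r in uniformNode a b n m..uniformNode a b n (m + 1), |f r| := by
        refine Finset.sum_le_sum fun m hm => ?_
        have hm := Finset.mem_range.1 hm
        have hle := uniformNode_mono hab n m.le_succ
        rw [← intervalIntegral.integral_const_mul, ← intervalIntegral.integral_sub
          ((intervalIntegrable_between_nodes hab hf hn0 hm).const_mul _)
          (intervalIntegrable_between_nodes hab hfw hn0 hm),
          ← intervalIntegral.integral_const_mul, ← Real.norm_eq_abs]
        refine intervalIntegral.norm_integral_le_of_norm_le hle ?_
          ((intervalIntegrable_between_nodes hab hfa hn0 hm).const_mul _)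
        refine Filter.Eventually.of_forall fun r hr => ?_
        rw [← sub_mul, norm_mul, Real.norm_eq_abs (f r)]
        refine mul_le_mul_of_nonneg_right ?_ (abs_nonneg _)
        have h1 := uniformNode_mem_Icc hab hn0 hm.le
        have h2 := uniformNode_mem_Icc hab hn0 (Nat.succ_le_of_lt hm)
        have ht := htag n m
        refine (hδw _ ⟨h1.1.trans ht.1, ht.2.trans h2.2⟩ _
          ⟨h1.1.trans hr.1.le, hr.2.trans h2.2⟩ ?_).le
        have hs := uniformNode_succ_sub a b n m
        rw [Real.dist_eq, abs_lt]
        constructor <;> linarith [ht.1, ht.2, hr.1, hr.2]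
    _ = ε / (J + 1) * J := by rw [← Finset.mul_sum, sum_integral_uniformNode hab hfa hn0]
    _ < ε := by
        rw [div_mul_eq_mul_div, div_lt_iff₀ (by positivity)]
        nlinarith

/-- Left Riemann sums of a continuous function converge to its integral. -/
lemma tendsto_sum_uniformNode {a b : ℝ} (hab : a ≤ b) {g : ℝ → ℝ} (hg : Continuous g) :
    Filter.Tendsto (fun n : ℕ => ∑ m ∈ Finset.range n, g (uniformNode a b n m) * ((b - a) / n))
      Filter.atTop (nhds (∫ r in a..b, g r)) := by
  have h := tendsto_sum_tag_mul_integral hab (f := fun _ => 1) intervalIntegrable_const hg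
    (fun n m => uniformNode a b n m)
    (fun n m => ⟨le_rfl, uniformNode_mono hab n m.le_succ⟩)
  simpa only [intervalIntegral.integral_const, uniformNode_succ_sub, smul_eq_mul, mul_one] using h

/-- Left-point sums `∑ F(rₘ) (w(rₘ₊₁) - w(rₘ))`. -/
noncomputable def stieltjesSum (F : ℝ → ℝ) (a b : ℝ) (n : ℕ) (w : ℝ → ℝ) : ℝ :=
  ∑ m ∈ Finset.range n,
    F (uniformNode a b n m) * (w (uniformNode a b n (m + 1)) - w (uniformNode a b n m))

/-- The Stieltjes integral `∫ F dw` for `F` with density `f`, defined by integration by parts. -/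
noncomputable def stieltjesIntegral (F f : ℝ → ℝ) (a b : ℝ) (w : ℝ → ℝ) : ℝ :=
  F b * w b - F a * w a - ∫ r in a..b, w r * f r

/-- Summation by parts: the telescoping sum of `F · w` minus the left-point sum is a sum of `w` at
the right node times the increment of `F`, that is, a tagged Riemann sum against `f`. -/
lemma tendsto_stieltjesSum {a b : ℝ} (hab : a ≤ b) {F f w : ℝ → ℝ}
    (hf : IntervalIntegrable f volume a b) (hw : Continuous w)
    (hF : ∀ x y, a ≤ x → x ≤ y → y ≤ b → ∫ r in x..y, f r = F y - F x) :
    Filter.Tendsto (fun n => stieltjesSum F a b n w) Filter.atTop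
      (nhds (stieltjesIntegral F f a b w)) := by
  have h := tendsto_sum_tag_mul_integral hab hf hw (fun n m => uniformNode a b n (m + 1))
    (fun n m => ⟨uniformNode_mono hab n m.le_succ, le_rfl⟩)
  refine (h.const_sub (F b * w b - F a * w a)).congr' ?_
  filter_upwards [Filter.eventually_ne_atTop 0] with n hn
  have htel := Finset.sum_range_sub
    (fun m => F (uniformNode a b n m) * w (uniformNode a b n m)) n
  rw [uniformNode_self a b hn, uniformNode_zero] at htel
  rw [← htel, ← Finset.sum_sub_distrib, stieltjesSum]
  refine Finset.sum_congr rfl fun m hm => ?_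
  have hm := Finset.mem_range.1 hm
  rw [hF _ _ (uniformNode_mem_Icc hab hn hm.le).1 (uniformNode_mono hab n m.le_succ)
    (uniformNode_mem_Icc hab hn hm).2]
  ring

/-! ### Wiener integrals: Gaussian law and independence. -/

/-- Characteristic functions converge by dominated convergence, and those of centred Gaussians
depend continuously on the variance. Zero variances are allowed. -/
lemma hasLaw_gaussianReal_of_tendsto {Ω : Type*} [MeasurableSpace Ω] {P : Measure Ω}
    [IsProbabilityMeasure P] {X : ℕ → Ω → ℝ} {Y : Ω → ℝ} {v : ℕ → ℝ≥0} {v' : ℝ≥0}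
    (hX : ∀ n, HasLaw (X n) (gaussianReal 0 (v n)) P)
    (hlim : ∀ᵐ ω ∂P, Filter.Tendsto (fun n => X n ω) Filter.atTop (nhds (Y ω)))
    (hv : Filter.Tendsto v Filter.atTop (nhds v')) :
    HasLaw Y (gaussianReal 0 v') P := by
  have hY : AEMeasurable Y P := aemeasurable_of_tendsto_metrizable_ae _
    (fun n => (hX n).aemeasurable) hlim
  refine ⟨hY, ?_⟩
  have := Measure.isProbabilityMeasure_map (μ := P) hY
  refine Measure.ext_of_charFun (funext fun x => ?_)
  have h1 : Filter.Tendsto (fun n => charFun (P.map (X n)) x) Filter.atTop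
      (nhds (charFun (P.map Y) x)) := by
    simp_rw [charFun_apply_real]
    rw [integral_map hY (by fun_prop)]
    simp_rw [fun n => integral_map (hX n).aemeasurable
      (f := fun y : ℝ => Complex.exp (x * y * Complex.I)) (by fun_prop)]
    refine tendsto_integral_of_dominated_convergence (fun _ => 1)
      (fun n => ?_) (integrable_const _) (fun n => ?_) ?_
    · have := (hX n).aemeasurable
      exact AEMeasurable.aestronglyMeasurable (by fun_prop)
    · refine Filter.Eventually.of_forall fun ω => ?_
      rw [← Complex.ofReal_mul, Complex.norm_exp_ofReal_mul_I]
    · filter_upwards [hlim] with ω hω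
      have hc : Continuous fun y : ℝ => Complex.exp (x * y * Complex.I) := by fun_prop
      exact (hc.tendsto _).comp hω
  refine tendsto_nhds_unique h1 ?_
  simp_rw [(hX _).map_eq, charFun_gaussianReal]
  have hv2 : Filter.Tendsto (fun n => ((v n : ℝ) : ℂ)) Filter.atTop (nhds ((v' : ℝ) : ℂ)) :=
    (Complex.continuous_ofReal.tendsto _).comp ((NNReal.continuous_coe.tendsto _).comp hv)
  exact (Complex.continuous_exp.tendsto _).comp
    (tendsto_const_nhds.sub ((hv2.mul_const _).div_const _))

namespace ProbabilityTheory

variable {Ω : Type*} [MeasurableSpace Ω] {P : Measure Ω} {B : ℝ≥0 → Ω → ℝ}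

/-- A path indexed by `ℝ≥0`, extended to the real line by its value at `0`. -/
noncomputable def extendPath (w : ℝ≥0 → ℝ) (r : ℝ) : ℝ := w r.toNNReal

lemma continuous_extendPath {w : ℝ≥0 → ℝ} (hw : Continuous w) : Continuous (extendPath w) :=
  hw.comp continuous_real_toNNReal

/-- The sum is a linear combination of jointly Gaussian, independent increments, each of variance
`(b - a) / n`, so only its mean and variance have to be computed. -/
lemma IsPreBrownianReal.hasLaw_stieltjesSum (hB : IsPreBrownianReal B P) {a b : ℝ} (ha : 0 ≤ a)
    (hab : a ≤ b) (F : ℝ → ℝ) (n : ℕ) :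
    HasLaw (fun ω => stieltjesSum F a b n (extendPath (B · ω)))
      (gaussianReal 0
        (∑ m ∈ Finset.range n, F (uniformNode a b n m) ^ 2 * ((b - a) / n)).toNNReal) P := by
  have hP := hB.isGaussianProcess.isProbabilityMeasure
  let t : Fin (n + 1) → ℝ≥0 := fun i => (uniformNode a b n i).toNNReal
  have ht : Monotone t := fun i j hij => Real.toNNReal_mono (uniformNode_mono hab n hij)
  let Y : Fin n → Ω → ℝ := fun i ω =>
    F (uniformNode a b n i) * (B (t i.succ) ω - B (t i.castSucc) ω)
  have hsum : (fun ω => stieltjesSum F a b n (extendPath (B · ω))) = fun ω => ∑ i, Y i ω := by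
    funext ω
    rw [stieltjesSum, Finset.sum_range]
    rfl
  have hY : ∀ i, HasGaussianLaw (Y i) P := fun i =>
    (hB.isGaussianProcess.hasGaussianLaw_sub (s := t i.succ) (t := t i.castSucc)).smul
      (F (uniformNode a b n i))
  have hlaw : HasGaussianLaw (fun ω => ∑ i, Y i ω) P := by
    have h := hB.isGaussianProcess.hasGaussianLaw_increments (t := t)
    refine (h.map_fun (∑ i : Fin n, F (uniformNode a b n i) •
      ContinuousLinearMap.proj (R := ℝ) (φ := fun _ : Fin n => ℝ) i)).congr ?_
    refine Filter.Eventually.of_forall fun ω => ?_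
    simp [Y]
  have hmean : P[fun ω => ∑ i, Y i ω] = 0 := by
    rw [integral_finsetSum _ fun i _ => (hY i).integrable]
    refine Finset.sum_eq_zero fun i _ => ?_
    simp only [Y]
    rw [integral_const_mul, integral_sub (hB.integrable_eval _) (hB.integrable_eval _),
      hB.integral_eval, hB.integral_eval, sub_zero, mul_zero]
  have hvar : Var[fun ω => ∑ i, Y i ω; P]
      = ∑ m ∈ Finset.range n, F (uniformNode a b n m) ^ 2 * ((b - a) / n) := by
    have hind : iIndepFun Y P := (hB.hasIndepIncrements n t ht).comp
      (fun i x => F (uniformNode a b n i) * x) (fun i => by fun_prop)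
    have h := IndepFun.variance_sum (X := Y) (s := Finset.univ) (μ := P)
      (fun i _ => (hY i).memLp_two) (fun i _ j _ hij => hind.indepFun hij)
    rw [← Finset.sum_fn, h, Finset.sum_range]
    refine Finset.sum_congr rfl fun i _ => ?_
    simp only [Y]
    rw [variance_const_mul]
    congr 1
    have h2 := (hB.hasLaw_sub (t i.succ) (t i.castSucc)).variance_eq
    rw [variance_id_gaussianReal] at h2
    refine h2.trans ?_
    have hs := uniformNode_succ_sub a b n i
    have hd := left_le_uniformNode hab n i
    have hd' := left_le_uniformNode hab n (i + 1)
    have hm := uniformNode_mono hab n (Nat.le_succ i)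
    simp only [coe_nndist, Real.dist_eq, t, NNReal.val_eq_coe, Fin.val_succ, Fin.val_castSucc]
    rw [Real.coe_toNNReal _ (by linarith), Real.coe_toNNReal _ (by linarith), hs, abs_of_nonneg]
    simp only [Nat.succ_eq_add_one] at hm
    linarith
  refine ⟨hsum ▸ hlaw.aemeasurable, ?_⟩
  rw [hsum, hlaw.map_eq_gaussianReal, hmean, hvar]

/-- The Wiener integral of `F` over `[a, b]` is centred Gaussian with variance `∫ F²`. -/
lemma IsBrownianReal.hasLaw_stieltjesIntegral (hB : IsBrownianReal B P) {a b : ℝ} (ha : 0 ≤ a)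
    (hab : a ≤ b) {F f : ℝ → ℝ} (hFc : Continuous F) (hf : IntervalIntegrable f volume a b)
    (hF : ∀ x y, a ≤ x → x ≤ y → y ≤ b → ∫ r in x..y, f r = F y - F x) :
    HasLaw (fun ω => stieltjesIntegral F f a b (extendPath (B · ω)))
      (gaussianReal 0 (∫ r in a..b, F r ^ 2).toNNReal) P := by
  have hP := hB.isGaussianProcess.isProbabilityMeasure
  refine hasLaw_gaussianReal_of_tendsto
    (fun n => hB.toIsPreBrownianReal.hasLaw_stieltjesSum ha hab F n) ?_ ?_
  · filter_upwards [hB.cont] with ω hω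
    exact tendsto_stieltjesSum hab hf (continuous_extendPath hω) hF
  · exact (continuous_real_toNNReal.tendsto _).comp
      (tendsto_sum_uniformNode hab (g := fun r => F r ^ 2) (by fun_prop))

lemma stieltjesIntegral_linear {a b : ℝ} {F f G g w : ℝ → ℝ} (hw : Continuous w)
    (hf : IntervalIntegrable f volume a b) (hg : IntervalIntegrable g volume a b) (x y : ℝ) :
    stieltjesIntegral (fun r => x * F r + y * G r) (fun r => x * f r + y * g r) a b w
      = x * stieltjesIntegral F f a b w + y * stieltjesIntegral G g a b w := by
  have h : ∫ r in a..b, w r * (x * f r + y * g r)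
      = x * (∫ r in a..b, w r * f r) + y * ∫ r in a..b, w r * g r := by
    rw [← intervalIntegral.integral_const_mul, ← intervalIntegral.integral_const_mul,
      ← intervalIntegral.integral_add ((hf.continuousOn_mul hw.continuousOn).const_mul _)
        ((hg.continuousOn_mul hw.continuousOn).const_mul _)]
    congr 1
    ext r
    ring
  simp only [stieltjesIntegral, h]
  ring

/-- Wiener integrals of orthogonal functions are independent. -/
lemma IsBrownianReal.indepFun_stieltjesIntegral (hB : IsBrownianReal B P) {a b : ℝ} (ha : 0 ≤ a)
    (hab : a ≤ b) {F f G g : ℝ → ℝ} (hFc : Continuous F) (hGc : Continuous G)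
    (hf : IntervalIntegrable f volume a b) (hg : IntervalIntegrable g volume a b)
    (hF : ∀ x y, a ≤ x → x ≤ y → y ≤ b → ∫ r in x..y, f r = F y - F x)
    (hG : ∀ x y, a ≤ x → x ≤ y → y ≤ b → ∫ r in x..y, g r = G y - G x)
    (horth : ∫ r in a..b, F r * G r = 0) :
    IndepFun (fun ω => stieltjesIntegral F f a b (extendPath (B · ω)))
      (fun ω => stieltjesIntegral G g a b (extendPath (B · ω))) P := by
  have hP := hB.isGaussianProcess.isProbabilityMeasure
  have hLF := hB.hasLaw_stieltjesIntegral ha hab hFc hf hF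
  have hLG := hB.hasLaw_stieltjesIntegral ha hab hGc hg hG
  set X := fun ω => stieltjesIntegral F f a b (extendPath (B · ω))
  set Y := fun ω => stieltjesIntegral G g a b (extendPath (B · ω))
  have hX := hLF.aemeasurable
  have hY := hLG.aemeasurable
  rw [indepFun_iff_charFun_prod hX hY]
  intro t
  obtain ⟨x, y⟩ := t
  have hint : ∀ {H : ℝ → ℝ}, Continuous H → IntervalIntegrable H volume a b :=
    fun h => h.intervalIntegrable _ _
  have hsub : ∀ p q, a ≤ p → p ≤ q → q ≤ b → Set.uIcc p q ⊆ Set.uIcc a b := by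
    intro p q hp hpq hq
    rw [Set.uIcc_of_le hpq, Set.uIcc_of_le hab]
    exact Set.Icc_subset_Icc hp hq
  have hLZ := hB.hasLaw_stieltjesIntegral ha hab (F := fun r => x * F r + y * G r)
    (f := fun r => x * f r + y * g r) (by fun_prop) ((hf.const_mul _).add (hg.const_mul _))
    (fun p q hp hpq hq => by
      rw [intervalIntegral.integral_add ((hf.mono_set (hsub p q hp hpq hq)).const_mul _)
        ((hg.mono_set (hsub p q hp hpq hq)).const_mul _), intervalIntegral.integral_const_mul,
        intervalIntegral.integral_const_mul, hF p q hp hpq hq, hG p q hp hpq hq]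
      ring)
  -- By orthogonality the variance of the combined integral splits, which is what makes its
  -- characteristic function factor.
  have hvar : ∫ r in a..b, (x * F r + y * G r) ^ 2
      = x ^ 2 * (∫ r in a..b, F r ^ 2) + y ^ 2 * ∫ r in a..b, G r ^ 2 := by
    have : ∀ r, (x * F r + y * G r) ^ 2
        = x ^ 2 * F r ^ 2 + y ^ 2 * G r ^ 2 + 2 * x * y * (F r * G r) := fun r => by ring
    simp_rw [this]
    rw [intervalIntegral.integral_add (hint (by fun_prop)) (hint (by fun_prop)),
      intervalIntegral.integral_add (hint (by fun_prop)) (hint (by fun_prop)),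
      intervalIntegral.integral_const_mul, intervalIntegral.integral_const_mul,
      intervalIntegral.integral_const_mul, horth, mul_zero, add_zero]
  have hsq : ∀ H : ℝ → ℝ, 0 ≤ ∫ r in a..b, H r ^ 2 := fun H =>
    intervalIntegral.integral_nonneg hab fun _ _ => sq_nonneg _
  -- The joint characteristic function at `(x, y)` is that of `x X + y Y` at 1, and this combination
  -- is again a Wiener integral.
  have hchar : charFun (P.map (fun ω => WithLp.toLp 2 (X ω, Y ω))) (WithLp.toLp 2 (x, y))
      = charFun (P.map fun ω => stieltjesIntegral (fun r => x * F r + y * G r)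
        (fun r => x * f r + y * g r) a b (extendPath (B · ω))) 1 := by
    rw [charFun_apply, charFun_apply_real, integral_map (by fun_prop) (by fun_prop),
      integral_map hLZ.aemeasurable (by fun_prop)]
    refine integral_congr_ae ?_
    filter_upwards [hB.cont] with ω hω
    rw [stieltjesIntegral_linear (continuous_extendPath hω) hf hg]
    simp [X, Y, WithLp.prod_inner_apply]
  rw [hchar, hLZ.map_eq, hLF.map_eq, hLG.map_eq, charFun_gaussianReal, charFun_gaussianReal,
    charFun_gaussianReal, ← Complex.exp_add, Real.coe_toNNReal _ (hsq _),
    Real.coe_toNNReal _ (hsq _), Real.coe_toNNReal _ (hsq _), hvar]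
  congr 1
  push_cast
  ring

end ProbabilityTheory

/-! ### Sign and modulus of a centred Gaussian. -/

lemma Real.measurable_sign : Measurable Real.sign :=
  Measurable.ite measurableSet_Iio measurable_const
    (Measurable.ite measurableSet_Ioi measurable_const measurable_const)

lemma Real.abs_mul_sign (x : ℝ) : |x| * Real.sign x = x := by
  rcases lt_trichotomy x 0 with h | rfl | h
  · rw [abs_of_neg h, Real.sign_of_neg h]; ring
  · simp
  · rw [abs_of_pos h, Real.sign_of_pos h]; ring

namespace ProbabilityTheory

variable {Ω : Type*} [MeasurableSpace Ω] {P : Measure Ω}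

/-- Both hypotheses together say that the law of the triple is the product of the three marginals;
reassociating that product gives the conclusion. -/
lemma IndepFun.prodMk_right_of_prodMk_left [IsProbabilityMeasure P] {α β γ : Type*} [MeasurableSpace α] [MeasurableSpace β]
    [MeasurableSpace γ] {X : Ω → α} {Y : Ω → β} {Z : Ω → γ} (hX : AEMeasurable X P)
    (hY : AEMeasurable Y P) (hZ : AEMeasurable Z P) (hXY : IndepFun X Y P)
    (hXYZ : IndepFun (fun ω => (X ω, Y ω)) Z P) : IndepFun X (fun ω => (Y ω, Z ω)) P := by
  have hYZ : IndepFun Y Z P := hXYZ.comp (φ := Prod.snd) (ψ := id) measurable_snd measurable_id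
  have := Measure.isProbabilityMeasure_map (μ := P) hX
  have := Measure.isProbabilityMeasure_map (μ := P) hY
  have := Measure.isProbabilityMeasure_map (μ := P) hZ
  rw [indepFun_iff_map_prod_eq_prod_map_map (by fun_prop) (by fun_prop)] at hXY hXYZ hYZ ⊢
  rw [hYZ, ← Measure.prodAssoc_prod, ← hXY, ← hXYZ,
    AEMeasurable.map_map_of_aemeasurable (by fun_prop) (by fun_prop)]
  rfl

/-- Reflection exchanges the two halves of a symmetric set, and the origin carries no mass. -/
lemma gaussianReal_zero_real_inter_Ioi {v : ℝ≥0} (hv : v ≠ 0) {A : Set ℝ}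
    (hA : MeasurableSet A) (hsymm : Neg.neg ⁻¹' A = A) :
    (gaussianReal 0 v).real (A ∩ Set.Ioi 0) = (gaussianReal 0 v).real A / 2 ∧
    (gaussianReal 0 v).real (A ∩ Set.Iio 0) = (gaussianReal 0 v).real A / 2 := by
  set μ := gaussianReal 0 v with hμ
  have hnull : NullSingletonClass μ := nullSingletonClass_gaussianReal hv
  have hneg : μ.map (fun x => -x) = μ := by rw [hμ, gaussianReal_map_neg, neg_zero]
  have h1 : μ.real (A ∩ Set.Iio 0) = μ.real (A ∩ Set.Ioi 0) := by
    rw [← hneg, map_measureReal_apply measurable_neg (hA.inter measurableSet_Iio), hneg]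
    congr 1
    rw [Set.preimage_inter, hsymm]
    ext x
    simp
  have h2 : μ.real A = μ.real (A ∩ Set.Ioi 0) + μ.real (A ∩ Set.Iio 0) := by
    rw [← measureReal_inter_add_sdiff (s := A) (t := Set.Ioi 0) measurableSet_Ioi]
    congr 1
    refine measureReal_congr ?_
    have h0 : ∀ᵐ x ∂μ, x ≠ 0 := by
      rw [ae_iff]; simp
    filter_upwards [h0] with x hx
    refine propext (and_congr_right fun _ => ?_)
    change (¬ 0 < x) ↔ x < 0
    exact ⟨fun h => lt_of_le_of_ne (not_lt.1 h) hx, fun h => not_lt.2 h.le⟩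
  constructor <;> linarith

/-- For a centred nondegenerate Gaussian, the modulus and the sign are independent. -/
lemma HasLaw.indepFun_abs_sign {D : Ω → ℝ} {v : ℝ≥0} (hv : v ≠ 0)
    (hD : HasLaw D (gaussianReal 0 v) P) :
    IndepFun (fun ω => |D ω|) (fun ω => Real.sign (D ω)) P := by
  rw [indepFun_iff_measure_inter_preimage_eq_mul]
  intro A B hA hB
  set A' : Set ℝ := (fun x => |x|) ⁻¹' A
  set B' : Set ℝ := Real.sign ⁻¹' B
  have hA' : MeasurableSet A' := measurable_abs hA
  have hB' : MeasurableSet B' := Real.measurable_sign hB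
  have hpre : ∀ {s : Set ℝ}, MeasurableSet s → P (D ⁻¹' s) = gaussianReal 0 v s := fun hs => by
    rw [← hD.map_eq, Measure.map_apply_of_aemeasurable hD.aemeasurable hs]
  change P (D ⁻¹' (A' ∩ B')) = P (D ⁻¹' A') * P (D ⁻¹' B')
  rw [hpre (hA'.inter hB'), hpre hA', hpre hB']
  have hnull : NullSingletonClass (gaussianReal 0 v) := nullSingletonClass_gaussianReal hv
  have h0 : ∀ᵐ x ∂(gaussianReal 0 v), x ≠ 0 := by
    rw [ae_iff]; simp
  have hAs := gaussianReal_zero_real_inter_Ioi hv hA' (by ext x; simp [A'])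
  have hUs := gaussianReal_zero_real_inter_Ioi hv MeasurableSet.univ (by simp)
  rw [Set.univ_inter, Set.univ_inter, probReal_univ] at hUs
  rw [← ENNReal.toReal_eq_toReal_iff' (measure_ne_top _ _)
    (ENNReal.mul_ne_top (measure_ne_top _ _) (measure_ne_top _ _)), ENNReal.toReal_mul]
  change (gaussianReal 0 v).real (A' ∩ B')
    = (gaussianReal 0 v).real A' * (gaussianReal 0 v).real B'
  have key : ∀ S : Set ℝ, (∀ x ≠ 0, x ∈ B' ↔ x ∈ S) →
      (gaussianReal 0 v).real (A' ∩ S)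
        = (gaussianReal 0 v).real A' * (gaussianReal 0 v).real S →
      (gaussianReal 0 v).real (A' ∩ B')
        = (gaussianReal 0 v).real A' * (gaussianReal 0 v).real B' := by
    intro S hS h
    have hae : B' =ᵐ[gaussianReal 0 v] S := by
      filter_upwards [h0] with x hx using propext (hS x hx)
    rw [measureReal_congr hae, ← h]
    exact measureReal_congr (Filter.EventuallyEq.rfl.inter hae)
  have hpos : ∀ x : ℝ, 0 < x → (x ∈ B' ↔ (1 : ℝ) ∈ B) := fun x hx => by
    simp [B', Real.sign_of_pos hx]
  have hneg : ∀ x : ℝ, x < 0 → (x ∈ B' ↔ (-1 : ℝ) ∈ B) := fun x hx => by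
    simp [B', Real.sign_of_neg hx]
  -- Off the origin the sign only takes the values 1 and -1, so `B'` is almost everywhere the line,
  -- a half-line or empty.
  by_cases h1 : (1 : ℝ) ∈ B <;> by_cases h2 : (-1 : ℝ) ∈ B
  · refine key Set.univ (fun x hx => ?_) (by simp)
    rcases lt_or_gt_of_ne hx with h | h
    · simp [hneg x h, h2]
    · simp [hpos x h, h1]
  · refine key (Set.Ioi 0) (fun x hx => ?_) (by rw [hAs.1, hUs.1]; ring)
    rcases lt_or_gt_of_ne hx with h | h
    · simp [hneg x h, h2, h.le]
    · simp [hpos x h, h1, h]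
  · refine key (Set.Iio 0) (fun x hx => ?_) (by rw [hAs.2, hUs.2]; ring)
    rcases lt_or_gt_of_ne hx with h | h
    · simp [hneg x h, h2, h]
    · simp [hpos x h, h1, h.le]
  · refine key ∅ (fun x hx => ?_) (by simp)
    rcases lt_or_gt_of_ne hx with h | h
    · simp [hneg x h, h2]
    · simp [hpos x h, h1]

lemma integral_abs_gaussianReal_zero (v : ℝ≥0) :
    ∫ x, |x| ∂(gaussianReal 0 v) = √(2 * v / Real.pi) := by
  rcases eq_or_ne v 0 with rfl | hv
  · simp
  have hv' : (0 : ℝ) < v := by positivity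
  rw [integral_gaussianReal_eq_integral_smul hv]
  simp only [gaussianPDFReal, sub_zero, smul_eq_mul]
  have habs := integral_comp_abs (f := fun x => (√(2 * Real.pi * v))⁻¹ *
    Real.exp (-x ^ 2 / (2 * v)) * x)
  simp only [sq_abs] at habs
  rw [habs]
  -- This is ∫₀^∞ x exp(-b x²) dx = 1/(2b) with b = 1/(2v), read off from the complex version.
  have hIoi : ∫ x in Set.Ioi (0 : ℝ), Real.exp (-x ^ 2 / (2 * v)) * x = v := by
    have h := integral_mul_cexp_neg_mul_sq (b := ((1 / (2 * v) : ℝ) : ℂ))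
      (by rw [Complex.ofReal_re]; positivity)
    have h2 : ((∫ x in Set.Ioi (0 : ℝ), Real.exp (-x ^ 2 / (2 * v)) * x : ℝ) : ℂ)
        = ((v : ℝ) : ℂ) := by
      rw [← integral_complex_ofReal]
      rw [show ((v : ℝ) : ℂ) = (2 * ((1 / (2 * v) : ℝ) : ℂ))⁻¹ by push_cast; field_simp, ← h]
      refine integral_congr_ae (Filter.Eventually.of_forall fun x => ?_)
      simp only
      rw [Complex.ofReal_mul, Complex.ofReal_exp, mul_comm]
      congr 2
      push_cast
      ring
    exact_mod_cast h2
  simp_rw [mul_assoc (√(2 * Real.pi * v))⁻¹]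
  rw [integral_const_mul, hIoi, eq_comm, Real.sqrt_eq_iff_mul_self_eq (by positivity)
    (by positivity)]
  have hs : √(2 * Real.pi * v) ^ 2 = 2 * Real.pi * v := Real.sq_sqrt (by positivity)
  have hs0 : √(2 * Real.pi * v) ≠ 0 := by positivity
  rw [show (2 * ((√(2 * Real.pi * v))⁻¹ * (v : ℝ))) * (2 * ((√(2 * Real.pi * v))⁻¹ * (v : ℝ)))
    = 4 * v ^ 2 / √(2 * Real.pi * v) ^ 2 by field_simp; ring, hs]
  field_simp
  ring

end ProbabilityTheory

/-! ### Conditional moments given the sign. -/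

namespace ProbabilityTheory

variable {Ω : Type*} [MeasurableSpace Ω] {P : Measure Ω}

lemma IndepFun.condExp_comp_eq_integral [IsProbabilityMeasure P] {α β : Type*} [MeasurableSpace α] [MeasurableSpace β]
    {U : Ω → α} {n : Ω → β} (hU : AEMeasurable U P) (hn : Measurable n) (h : IndepFun U n P)
    {g : α → ℝ} (hg : Measurable g) :
    P[fun ω => g (U ω) | MeasurableSpace.comap n inferInstance]
      =ᵐ[P] fun _ => ∫ ω, g (U ω) ∂P := by
  have hae : (fun ω => g (U ω)) =ᵐ[P] fun ω => g (hU.mk U ω) := by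
    filter_upwards [hU.ae_eq_mk] with ω hω
    rw [hω]
  have hmeas : Measurable fun ω => g (hU.mk U ω) := hg.comp hU.measurable_mk
  have hind : IndepFun (fun ω => g (hU.mk U ω)) n P :=
    (h.comp hg measurable_id).congr hae Filter.EventuallyEq.rfl
  rw [integral_congr_ae hae]
  exact (condExp_congr_ae hae).trans (condExp_indep_eq hmeas.comap_le hn.comap_le
    (comap_measurable _).stronglyMeasurable hind)

lemma HasLaw.integral_abs {D : Ω → ℝ} {v : ℝ≥0} (hD : HasLaw D (gaussianReal 0 v) P) :
    ∫ ω, |D ω| ∂P = √(2 * v / Real.pi) := by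
  rw [← integral_abs_gaussianReal_zero, ← hD.map_eq,
    integral_map hD.aemeasurable (by fun_prop)]

lemma HasLaw.integral_sq {D : Ω → ℝ} {v : ℝ≥0} (hD : HasLaw D (gaussianReal 0 v) P) :
    ∫ ω, D ω ^ 2 ∂P = v := by
  have h := hD.variance_eq
  rw [variance_id_gaussianReal, variance_of_integral_eq_zero hD.aemeasurable
    (by rw [hD.integral_eq, integral_id_gaussianReal])] at h
  exact h

/-- First two conditional moments of `R + c D` given a variable `n` which determines the sign of
`D` and is independent of the pair `(R, |D|)`. -/
theorem condExp_condVar_add_mul_of_sign [IsProbabilityMeasure P] {β : Type*} [MeasurableSpace β] {R D ν : Ω → ℝ}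
    {n : Ω → β} {vR vD : ℝ≥0} (c : ℝ) (hvD : vD ≠ 0) (hn : Measurable n)
    (hR : HasLaw R (gaussianReal 0 vR) P) (hD : HasLaw D (gaussianReal 0 vD) P)
    (hRD : IndepFun R D P) (hind : IndepFun (fun ω => (R ω, |D ω|)) n P)
    (hν : Measurable[MeasurableSpace.comap n inferInstance] ν)
    (hνD : ν =ᵐ[P] fun ω => Real.sign (D ω)) :
    P[fun ω => R ω + c * D ω | MeasurableSpace.comap n inferInstance]
      =ᵐ[P] (fun ω => c * √(2 * vD / Real.pi) * ν ω) ∧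
    Var[fun ω => R ω + c * D ω; P | MeasurableSpace.comap n inferInstance]
      =ᵐ[P] fun _ => vR + c ^ 2 * vD - c ^ 2 * (2 * vD / Real.pi) := by
  have hRL := hR.hasGaussianLaw.memLp_two
  have hDL := hD.hasGaussianLaw.memLp_two
  have hRm := hR.aemeasurable
  have hDm := hD.aemeasurable
  have hU : AEMeasurable (fun ω => (R ω, |D ω|)) P := by fun_prop
  have hνs : StronglyMeasurable[MeasurableSpace.comap n inferInstance] ν :=
    hν.stronglyMeasurable
  have hR0 : ∫ ω, R ω ∂P = 0 := by rw [hR.integral_eq, integral_id_gaussianReal]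
  have hRabs : IndepFun R (fun ω => |D ω|) P := hRD.comp measurable_id measurable_abs
  have e1 := hind.condExp_comp_eq_integral hU hn (g := fun p => p.1) (by fun_prop)
  have e2 := hind.condExp_comp_eq_integral hU hn (g := fun p => p.2) (by fun_prop)
  have e3 := hind.condExp_comp_eq_integral hU hn (g := fun p => p.1 ^ 2) (by fun_prop)
  have e4 := hind.condExp_comp_eq_integral hU hn (g := fun p => p.2 ^ 2) (by fun_prop)
  have e5 := hind.condExp_comp_eq_integral hU hn (g := fun p => p.1 * p.2) (by fun_prop)
  simp only at e1 e2 e3 e4 e5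
  rw [hR0] at e1
  rw [hD.integral_abs] at e2
  rw [hR.integral_sq] at e3
  simp_rw [sq_abs] at e4
  rw [hD.integral_sq] at e4
  rw [hRabs.integral_fun_mul_eq_mul_integral (by fun_prop) (by fun_prop), hR0, zero_mul] at e5
  -- The factor `ν` is measurable for the conditioning and comes out of conditional expectations,
  -- leaving functions of `(R, |D|)`, whose conditional expectations are constants.
  have hDν : ∀ᵐ ω ∂P, |D ω| * ν ω = D ω := by
    filter_upwards [hνD] with ω hω
    rw [hω, Real.abs_mul_sign]
  have hRi : Integrable R P := hR.hasGaussianLaw.integrable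
  have hDi : Integrable D P := hD.hasGaussianLaw.integrable
  have hRabsi : Integrable (fun ω => R ω * |D ω|) P := hRL.integrable_mul hDL.abs
  have hRDi : Integrable (fun ω => R ω * D ω) P := hRL.integrable_mul hDL
  have hprod : Integrable (fun ω => |D ω| * ν ω) P :=
    hDi.congr (hDν.mono fun ω h => h.symm)
  have hprod2 : Integrable (fun ω => R ω * |D ω| * ν ω) P :=
    hRDi.congr (hDν.mono fun ω h => by simp only; rw [mul_assoc, h])
  have hKL : MemLp (fun ω => R ω + c * D ω) 2 P := hRL.add (hDL.const_mul c)
  have eD : P[fun ω => D ω | MeasurableSpace.comap n inferInstance]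
      =ᵐ[P] fun ω => √(2 * vD / Real.pi) * ν ω := by
    have h := condExp_mul_of_stronglyMeasurable_right hνs hprod hDi.abs
    filter_upwards [condExp_congr_ae (m := MeasurableSpace.comap n inferInstance) hDν, h, e2]
      with ω h1 h2 h3
    rw [← h1]
    refine h2.trans ?_
    simp only [Pi.mul_apply, h3]
  have eRD : P[fun ω => R ω * D ω | MeasurableSpace.comap n inferInstance]
      =ᵐ[P] fun _ => 0 := by
    have h := condExp_mul_of_stronglyMeasurable_right hνs hprod2 hRabsi
    have hc : (fun ω => R ω * |D ω| * ν ω) =ᵐ[P] fun ω => R ω * D ω :=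
      hDν.mono fun ω h => by simp only; rw [mul_assoc, h]
    filter_upwards [condExp_congr_ae (m := MeasurableSpace.comap n inferInstance) hc, h, e5]
      with ω h1 h2 h3
    rw [← h1]
    refine h2.trans ?_
    simp only [Pi.mul_apply, h3, zero_mul]
  have hmean : P[fun ω => R ω + c * D ω | MeasurableSpace.comap n inferInstance]
      =ᵐ[P] (fun ω => c * √(2 * vD / Real.pi) * ν ω) := by
    have h1 := condExp_add hRi (hDi.const_mul c) (MeasurableSpace.comap n inferInstance)
    have h2 := condExp_smul (μ := P) c D (MeasurableSpace.comap n inferInstance)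
    filter_upwards [h1, h2, e1, eD] with ω h1 h2 h3 h4
    refine h1.trans ?_
    rw [Pi.add_apply, h3, zero_add]
    refine h2.trans ?_
    rw [Pi.smul_apply, smul_eq_mul, mul_assoc]
    exact congrArg _ h4
  refine ⟨hmean, ?_⟩
  have hsq : P[(fun ω => R ω + c * D ω) ^ 2 | MeasurableSpace.comap n inferInstance]
      =ᵐ[P] fun _ => vR + c ^ 2 * vD := by
    have hexp : (fun ω => R ω + c * D ω) ^ 2
        = (fun ω => R ω ^ 2) + ((c ^ 2) • (fun ω => D ω ^ 2)
          + (2 * c) • fun ω => R ω * D ω) := by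
      ext ω
      simp only [Pi.pow_apply, Pi.add_apply, Pi.smul_apply, smul_eq_mul]
      ring
    rw [hexp]
    have h1 := condExp_add hRL.integrable_sq ((hDL.integrable_sq.smul (c ^ 2)).add
      (hRDi.smul (2 * c))) (MeasurableSpace.comap n inferInstance)
    have h2 := condExp_add (hDL.integrable_sq.smul (c ^ 2))
      (hRDi.smul (2 * c)) (MeasurableSpace.comap n inferInstance)
    have h3 := condExp_smul (μ := P) (c ^ 2) (fun ω => D ω ^ 2)
      (MeasurableSpace.comap n inferInstance)
    have h4 := condExp_smul (μ := P) (2 * c) (fun ω => R ω * D ω)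
      (MeasurableSpace.comap n inferInstance)
    filter_upwards [h1, h2, h3, h4, e3, e4, eRD] with ω h1 h2 h3 h4 h5 h6 h7
    rw [h1, Pi.add_apply, h2, Pi.add_apply, h3, h4, h5, Pi.smul_apply, Pi.smul_apply, h6, h7]
    simp
  have hnull : NullSingletonClass (gaussianReal 0 vD) := nullSingletonClass_gaussianReal hvD
  have hD0 : ∀ᵐ ω ∂P, D ω ≠ 0 := by
    have h : ∀ᵐ x ∂(P.map D), x ≠ 0 := by
      rw [hD.map_eq, ae_iff]; simp
    exact ae_of_ae_map hDm h
  filter_upwards [condVar_ae_eq_condExp_sq_sub_sq_condExp hn.comap_le hKL, hsq, hmean, hνD, hD0]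
    with ω h1 h2 h3 h4 h5
  -- `Real.sign 0 = 0`, so this needs `D ω ≠ 0`, which holds almost surely because `vD ≠ 0`.
  have hν2 : ν ω ^ 2 = 1 := by
    rw [h4]
    rcases lt_or_gt_of_ne h5 with h | h
    · simp [Real.sign_of_neg h]
    · simp [Real.sign_of_pos h]
  rw [h1, Pi.sub_apply, Pi.pow_apply, h2, h3, mul_pow, mul_pow, hν2,
    Real.sq_sqrt (by positivity), mul_one]

end ProbabilityTheory

/-! ### The kernels and their inner products. -/

/-- A single antiderivative, centred at an arbitrary `p`, serves every polynomial integral below;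
unused degrees are padded with zero coefficients. -/
lemma integral_quartic (c₀ c₁ c₂ c₃ c₄ p a b : ℝ) :
    ∫ r in a..b, (c₀ + c₁ * (r - p) + c₂ * (r - p) ^ 2 + c₃ * (r - p) ^ 3 + c₄ * (r - p) ^ 4)
      = (c₀ * (b - p) + c₁ * (b - p) ^ 2 / 2 + c₂ * (b - p) ^ 3 / 3 + c₃ * (b - p) ^ 4 / 4
          + c₄ * (b - p) ^ 5 / 5)
        - (c₀ * (a - p) + c₁ * (a - p) ^ 2 / 2 + c₂ * (a - p) ^ 3 / 3 + c₃ * (a - p) ^ 4 / 4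
          + c₄ * (a - p) ^ 5 / 5) := by
  refine intervalIntegral.integral_eq_sub_of_hasDerivAt (f := fun r =>
    c₀ * (r - p) + c₁ * (r - p) ^ 2 / 2 + c₂ * (r - p) ^ 3 / 3 + c₃ * (r - p) ^ 4 / 4
          + c₄ * (r - p) ^ 5 / 5) (fun r _ => ?_)
    (Continuous.intervalIntegrable (by fun_prop) _ _)
  have h : HasDerivAt (fun r : ℝ => r - p) 1 r := (hasDerivAt_id r).sub_const p
  have key := ((((h.const_mul c₀).add (((h.pow 2).const_mul c₁).div_const 2)).add
    (((h.pow 3).const_mul c₂).div_const 3)).add (((h.pow 4).const_mul c₃).div_const 4)).add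
    (((h.pow 5).const_mul c₄).div_const 5)
  refine key.congr_deriv ?_
  norm_num
  ring

lemma eval_intervalIntegral_piLp {d : ℕ} {a b : ℝ} {f : ℝ → EuclideanSpace ℝ (Fin d)}
    (hf : ∀ i, IntervalIntegrable (fun r => f r i) volume a b) (i : Fin d) :
    (∫ r in a..b, f r) i = ∫ r in a..b, f r i := by
  simp only [intervalIntegral]
  rw [← eval_integral_piLp (fun i => (hf i).1), ← eval_integral_piLp (fun i => (hf i).2)]
  rfl

/-- The integrand of the space-time-time area as a Wiener integral over `[s, t]`. -/
noncomputable def timeTimeKernel (s t r : ℝ) : ℝ := ((r - (s + t) / 2) / (t - s)) ^ 2 / 2 - 1 / 24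

/-- The derivative of `timeTimeKernel`. -/
noncomputable def timeTimeDensity (s t r : ℝ) : ℝ := (r - (s + t) / 2) / (t - s) ^ 2

/-- The integrand of the difference of the space-time areas over the two halves of `[s, t]`
as a Wiener integral. -/
noncomputable def swingKernel (s t r : ℝ) : ℝ := 2 * |(r - (s + t) / 2) / (t - s)| - 1 / 2

/-- The almost everywhere derivative of `swingKernel`. -/
noncomputable def swingDensity (s t r : ℝ) : ℝ :=
  if r ≤ (s + t) / 2 then -(2 / (t - s)) else 2 / (t - s)

lemma continuous_timeTimeKernel (s t : ℝ) : Continuous (timeTimeKernel s t) := by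
  unfold timeTimeKernel; fun_prop

lemma continuous_swingKernel (s t : ℝ) : Continuous (swingKernel s t) := by
  unfold swingKernel; fun_prop

lemma continuous_timeTimeDensity (s t : ℝ) : Continuous (timeTimeDensity s t) := by
  unfold timeTimeDensity; fun_prop

lemma intervalIntegrable_swingDensity {s t : ℝ} (hst : s < t) (a b : ℝ) :
    IntervalIntegrable (swingDensity s t) volume a b := by
  refine Monotone.intervalIntegrable fun x y hxy => ?_
  have : 0 < 2 / (t - s) := div_pos two_pos (by linarith)
  simp only [swingDensity]
  split_ifs <;> linarith

lemma integral_timeTimeDensity {s t : ℝ} (hst : s < t) (x y : ℝ) :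
    ∫ r in x..y, timeTimeDensity s t r = timeTimeKernel s t y - timeTimeKernel s t x := by
  have h0 : t - s ≠ 0 := by linarith
  have h := integral_quartic 0 (1 / (t - s) ^ 2) 0 0 0 ((s + t) / 2) x y
  have hc : ∀ r, timeTimeDensity s t r = 0 + 1 / (t - s) ^ 2 * (r - (s + t) / 2)
      + 0 * (r - (s + t) / 2) ^ 2 + 0 * (r - (s + t) / 2) ^ 3 + 0 * (r - (s + t) / 2) ^ 4 :=
    fun r => by simp only [timeTimeDensity]; ring
  simp_rw [hc]
  rw [h]
  simp only [timeTimeKernel]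
  field_simp
  ring

lemma integral_mul_swingDensity_left {s t x y : ℝ} {w : ℝ → ℝ} (hxy : x ≤ y)
    (hy : y ≤ (s + t) / 2) :
    ∫ r in x..y, w r * swingDensity s t r = -(2 / (t - s)) * ∫ r in x..y, w r := by
  rw [← intervalIntegral.integral_const_mul]
  refine intervalIntegral.integral_congr fun r hr => ?_
  rw [Set.uIcc_of_le hxy] at hr
  simp only [swingDensity, if_pos (hr.2.trans hy)]
  ring

lemma integral_mul_swingDensity_right {s t x y : ℝ} {w : ℝ → ℝ} (hxy : x ≤ y)
    (hx : (s + t) / 2 ≤ x) :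
    ∫ r in x..y, w r * swingDensity s t r = 2 / (t - s) * ∫ r in x..y, w r := by
  rw [← intervalIntegral.integral_const_mul]
  -- The open interval matters: at the midpoint itself `swingDensity` takes its left-hand value.
  refine intervalIntegral.integral_congr_uIoo fun r hr => ?_
  rw [Set.uIoo_of_le hxy] at hr
  simp only [swingDensity, if_neg (not_le.2 (hx.trans_lt hr.1))]
  ring

lemma integral_swingDensity {s t : ℝ} (hst : s < t) (x y : ℝ) :
    ∫ r in x..y, swingDensity s t r = swingKernel s t y - swingKernel s t x := by
  have hpos : 0 < t - s := by linarith
  -- Integrating from the midpoint, where the kernel equals -1/2, keeps the density constant on each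
  -- side.
  have key : ∀ y, ∫ r in (s + t) / 2..y, swingDensity s t r
      = swingKernel s t y + 1 / 2 := by
    intro y
    simp only [swingKernel]
    rcases le_total y ((s + t) / 2) with h | h
    · have h1 := integral_mul_swingDensity_left (w := fun _ => 1) h le_rfl
      simp only [one_mul, intervalIntegral.integral_const, smul_eq_mul, mul_one] at h1
      rw [intervalIntegral.integral_symm, h1, abs_of_nonpos
        (div_nonpos_of_nonpos_of_nonneg (by linarith) hpos.le)]
      field_simp
      ring
    · have h1 := integral_mul_swingDensity_right (w := fun _ => 1) h le_rfl
      simp only [one_mul, intervalIntegral.integral_const, smul_eq_mul, mul_one] at h1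
      rw [h1, abs_of_nonneg (div_nonneg (by linarith) hpos.le)]
      field_simp
      ring
  rw [← intervalIntegral.integral_interval_sub_left
    (intervalIntegrable_swingDensity hst ((s + t) / 2) y)
    (intervalIntegrable_swingDensity hst ((s + t) / 2) x), key, key]
  ring

/-- Rescaling to x = (r - m)/h maps `[s, t]` onto [-1/2, 1/2]; evenness then removes the absolute
value, so the later integrals are polynomial. -/
lemma integral_comp_abs_centred {s t : ℝ} (hst : s < t) {φ : ℝ → ℝ} (hφ : Continuous φ) :
    ∫ r in s..t, φ |(r - (s + t) / 2) / (t - s)|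
      = 2 * (t - s) * ∫ x in (0 : ℝ)..1 / 2, φ x := by
  have hpos : 0 < t - s := by linarith
  have hne : t - s ≠ 0 := hpos.ne'
  have hint : ∀ a b, IntervalIntegrable (fun x => φ |x|) volume a b :=
    fun a b => Continuous.intervalIntegrable (by fun_prop) _ _
  have h1 : ∫ r in s..t, φ |(r - (s + t) / 2) / (t - s)|
      = (t - s) * ∫ x in (-(1 / 2) : ℝ)..1 / 2, φ |x| := by
    have h := intervalIntegral.integral_comp_div_sub (fun x => φ |x|) (a := s) (b := t) hne
      ((s + t) / 2 / (t - s))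
    simp only [← sub_div] at h
    rw [h, smul_eq_mul]
    congr 2 <;> field_simp <;> ring
  have h2 : ∫ x in (0 : ℝ)..1 / 2, φ |x| = ∫ x in (0 : ℝ)..1 / 2, φ x := by
    refine intervalIntegral.integral_congr fun x hx => ?_
    rw [Set.uIcc_of_le (by norm_num)] at hx
    simp only [abs_of_nonneg hx.1]
  have h3 : ∫ x in (-(1 / 2) : ℝ)..0, φ |x| = ∫ x in (0 : ℝ)..1 / 2, φ |x| := by
    have h := intervalIntegral.integral_comp_neg (a := 0) (b := 1 / 2) (fun x => φ |x|)
    simp only [abs_neg, neg_zero] at h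
    exact h.symm
  rw [h1, ← intervalIntegral.integral_add_adjacent_intervals (hint _ 0) (hint 0 _), h3, h2]
  ring

lemma integral_swingKernel_sq {s t : ℝ} (hst : s < t) :
    ∫ r in s..t, swingKernel s t r ^ 2 = (t - s) / 12 := by
  have h := integral_comp_abs_centred hst (φ := fun x => (2 * x - 1 / 2) ^ 2) (by fun_prop)
  simp only [swingKernel]
  rw [h]
  have hq := integral_quartic (1 / 4) (-2) 4 0 0 0 0 (1 / 2)
  have hc : ∀ x : ℝ, (2 * x - 1 / 2) ^ 2 = 1 / 4 + (-2) * (x - 0) + 4 * (x - 0) ^ 2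
      + 0 * (x - 0) ^ 3 + 0 * (x - 0) ^ 4 := fun x => by ring
  simp_rw [hc]
  rw [hq]
  ring

/-- The component of `timeTimeKernel` orthogonal to `swingKernel`. -/
noncomputable def residualKernel (s t r : ℝ) : ℝ :=
  1 * timeTimeKernel s t r + (-(1 / 8)) * swingKernel s t r

/-- The almost everywhere derivative of `residualKernel`. -/
noncomputable def residualDensity (s t r : ℝ) : ℝ :=
  1 * timeTimeDensity s t r + (-(1 / 8)) * swingDensity s t r

lemma continuous_residualKernel (s t : ℝ) : Continuous (residualKernel s t) :=
  ((continuous_timeTimeKernel s t).const_mul _).add ((continuous_swingKernel s t).const_mul _)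

lemma intervalIntegrable_residualDensity {s t : ℝ} (hst : s < t) (a b : ℝ) :
    IntervalIntegrable (residualDensity s t) volume a b :=
  (((continuous_timeTimeDensity s t).intervalIntegrable a b).const_mul _).add
    ((intervalIntegrable_swingDensity hst a b).const_mul _)

lemma integral_residualDensity {s t : ℝ} (hst : s < t) (x y : ℝ) :
    ∫ r in x..y, residualDensity s t r = residualKernel s t y - residualKernel s t x := by
  simp only [residualDensity, residualKernel]
  rw [intervalIntegral.integral_add
    (((continuous_timeTimeDensity s t).intervalIntegrable x y).const_mul _)
    ((intervalIntegrable_swingDensity hst x y).const_mul _), intervalIntegral.integral_const_mul,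
    intervalIntegral.integral_const_mul, integral_timeTimeDensity hst, integral_swingDensity hst]
  ring

lemma residualKernel_eq (s t r : ℝ) : residualKernel s t r
    = |(r - (s + t) / 2) / (t - s)| ^ 2 / 2 - |(r - (s + t) / 2) / (t - s)| / 4 + 1 / 48 := by
  simp only [residualKernel, timeTimeKernel, swingKernel, sq_abs]
  ring

/-- Pythagoras: h/720 is the squared norm of `timeTimeKernel`, and h/768 = (1/8)² · h/12 that of its
projection on `swingKernel`. -/
lemma integral_residualKernel_sq {s t : ℝ} (hst : s < t) :
    ∫ r in s..t, residualKernel s t r ^ 2 = (1 / 720 - 1 / 768) * (t - s) := by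
  have h := integral_comp_abs_centred hst (φ := fun x => (x ^ 2 / 2 - x / 4 + 1 / 48) ^ 2)
    (by fun_prop)
  simp only [residualKernel_eq]
  rw [h]
  have hq := integral_quartic (1 / 48 ^ 2) (-(1 / 96)) (1 / 16 + 1 / 48) (-(1 / 4)) (1 / 4)
    0 0 (1 / 2)
  have hc : ∀ x : ℝ, (x ^ 2 / 2 - x / 4 + 1 / 48) ^ 2 = 1 / 48 ^ 2 + (-(1 / 96)) * (x - 0)
      + (1 / 16 + 1 / 48) * (x - 0) ^ 2 + (-(1 / 4)) * (x - 0) ^ 3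
      + (1 / 4) * (x - 0) ^ 4 := fun x => by ring
  simp_rw [hc]
  rw [hq]
  ring

/-- This orthogonality is what fixes the coefficient 1/8 = (h/96)/(h/12). -/
lemma integral_residualKernel_mul_swingKernel {s t : ℝ} (hst : s < t) :
    ∫ r in s..t, residualKernel s t r * swingKernel s t r = 0 := by
  have h := integral_comp_abs_centred hst
    (φ := fun x => (x ^ 2 / 2 - x / 4 + 1 / 48) * (2 * x - 1 / 2)) (by fun_prop)
  simp only [residualKernel_eq, swingKernel]
  rw [h]
  have hq := integral_quartic (-(1 / 96)) (1 / 8 + 1 / 24) (-(3 / 4)) 1 0 0 0 (1 / 2)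
  have hc : ∀ x : ℝ, (x ^ 2 / 2 - x / 4 + 1 / 48) * (2 * x - 1 / 2) = -(1 / 96)
      + (1 / 8 + 1 / 24) * (x - 0) + (-(3 / 4)) * (x - 0) ^ 2 + 1 * (x - 0) ^ 3
      + 0 * (x - 0) ^ 4 := fun x => by ring
  simp_rw [hc]
  rw [hq]
  ring

/-! ### Lévy areas of a continuous path as Wiener integrals. -/

section Paths

variable {Ω : Type*} {d : ℕ} {W : ℝ≥0 → Ω → EuclideanSpace ℝ (Fin d)} {ω : Ω}

lemma bridgeOn_apply (s t : ℝ≥0) (r : ℝ) (i : Fin d) :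
    bridgeOn W s t r ω i
      = (extendPath (fun q => W q ω i) r - extendPath (fun q => W q ω i) s)
        - (r - s) / ((t : ℝ) - s)
          * (extendPath (fun q => W q ω i) t - extendPath (fun q => W q ω i) s) := by
  simp [bridgeOn, extendPath]

lemma spaceTimeArea_apply (hW : ∀ i, Continuous fun q => W q ω i) {s t : ℝ≥0} (hst : s < t)
    (i : Fin d) :
    spaceTimeArea W s t ω i
      = 1 / ((t : ℝ) - s) * (∫ r in (s : ℝ)..t, extendPath (fun q => W q ω i) r)
        - (extendPath (fun q => W q ω i) s + extendPath (fun q => W q ω i) t) / 2 := by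
  have hst' : (s : ℝ) < t := hst
  have h0 : (t : ℝ) - s ≠ 0 := by linarith
  have hc : ∀ i, Continuous (extendPath fun q => W q ω i) := fun i => continuous_extendPath (hW i)
  have hb : ∀ i, Continuous fun r => bridgeOn W s t r ω i := fun i => by
    have := hc i
    simp only [bridgeOn_apply]
    fun_prop
  simp only [spaceTimeArea, PiLp.smul_apply, smul_eq_mul]
  rw [eval_intervalIntegral_piLp (fun i => (hb i).intervalIntegrable _ _)]
  simp only [bridgeOn_apply]
  set w := extendPath fun q => W q ω i
  have hw : Continuous w := hc i
  have hsplit : ∀ r, w r - w s - (r - s) / ((t : ℝ) - s) * (w t - w s)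
      = w r + (-w s + (-((w t - w s) / ((t : ℝ) - s))) * (r - s) + 0 * (r - s) ^ 2
        + 0 * (r - s) ^ 3 + 0 * (r - s) ^ 4) := fun r => by ring
  simp_rw [hsplit]
  rw [intervalIntegral.integral_add (hw.intervalIntegrable _ _)
    (Continuous.intervalIntegrable (by fun_prop) _ _), integral_quartic]
  field_simp
  ring

lemma spaceTimeTimeArea_apply (hW : ∀ i, Continuous fun q => W q ω i) {s t : ℝ≥0} (hst : s < t)
    (i : Fin d) :
    spaceTimeTimeArea W s t ω i = stieltjesIntegral (timeTimeKernel s t) (timeTimeDensity s t) s t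
      (extendPath fun q => W q ω i) := by
  have hst' : (s : ℝ) < t := hst
  have h0 : (t : ℝ) - s ≠ 0 := by linarith
  have hc : ∀ i, Continuous (extendPath fun q => W q ω i) := fun i => continuous_extendPath (hW i)
  have hb : ∀ i, Continuous fun r : ℝ =>
      ((1 / 2 * ((t : ℝ) - s) - (r - s)) • bridgeOn W s t r ω) i := fun i => by
    have := hc i
    simp only [PiLp.smul_apply, smul_eq_mul, bridgeOn_apply]
    fun_prop
  simp only [spaceTimeTimeArea, PiLp.smul_apply, smul_eq_mul]
  rw [eval_intervalIntegral_piLp (fun i => (hb i).intervalIntegrable _ _)]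
  simp only [PiLp.smul_apply, smul_eq_mul, bridgeOn_apply]
  set w := extendPath fun q => W q ω i
  have hw : Continuous w := hc i
  -- The weight h/2 - (r - s) is -h² times `timeTimeDensity`; the other terms, from the endpoint
  -- values of the bridge, form a quadratic in `r - s` and yield the boundary terms.
  have hsplit : ∀ r : ℝ, (1 / 2 * ((t : ℝ) - s) - (r - s))
        * (w r - w s - (r - s) / ((t : ℝ) - s) * (w t - w s))
      = (-((t : ℝ) - s) ^ 2) * (w r * timeTimeDensity s t r)
        + (-w s * ((t : ℝ) - s) / 2 + (w s - (w t - w s) / 2) * (r - s)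
          + ((w t - w s) / ((t : ℝ) - s)) * (r - s) ^ 2
        + 0 * (r - s) ^ 3 + 0 * (r - s) ^ 4) := fun r => by
    simp only [timeTimeDensity]
    field_simp
    ring
  have hd := continuous_timeTimeDensity s t
  simp_rw [hsplit]
  rw [intervalIntegral.integral_add (Continuous.intervalIntegrable (by fun_prop) _ _)
    (Continuous.intervalIntegrable (by fun_prop) _ _), integral_quartic,
    intervalIntegral.integral_const_mul]
  simp only [stieltjesIntegral, timeTimeKernel]
  field_simp
  ring

/-- The two midpoint values of the path cancel in the difference; `swingKernel` equals 1/2 at both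
ends, which gives the remaining boundary terms. -/
lemma spaceTimeArea_sub_apply (hW : ∀ i, Continuous fun q => W q ω i) {s t : ℝ≥0} (hst : s < t)
    (i : Fin d) :
    spaceTimeArea W s ((s + t) / 2) ω i - spaceTimeArea W ((s + t) / 2) t ω i
      = stieltjesIntegral (swingKernel s t) (swingDensity s t) s t
        (extendPath fun q => W q ω i) := by
  have hst' : (s : ℝ) < t := hst
  have h0 : (t : ℝ) - s ≠ 0 := by linarith
  have hu : (((s + t) / 2 : ℝ≥0) : ℝ) = ((s : ℝ) + t) / 2 := by push_cast; ring
  have h1 : s < (s + t) / 2 := by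
    rw [← NNReal.coe_lt_coe, hu]; linarith
  have h2 : (s + t) / 2 < t := by
    rw [← NNReal.coe_lt_coe, hu]; linarith
  have hw : Continuous (extendPath fun q => W q ω i) := continuous_extendPath (hW i)
  rw [spaceTimeArea_apply hW h1, spaceTimeArea_apply hW h2, hu]
  set w := extendPath fun q => W q ω i
  have hi : ∀ a b, IntervalIntegrable (fun r => w r * swingDensity s t r) volume a b :=
    fun a b => (intervalIntegrable_swingDensity hst' a b).continuousOn_mul hw.continuousOn
  simp only [stieltjesIntegral, swingKernel]
  rw [← intervalIntegral.integral_add_adjacent_intervals (hi s (((s : ℝ) + t) / 2)) (hi _ t),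
    integral_mul_swingDensity_left (by linarith) le_rfl,
    integral_mul_swingDensity_right (by linarith) le_rfl]
  have e1 : |((t : ℝ) - (s + t) / 2) / (t - s)| = 1 / 2 := by
    rw [show ((t : ℝ) - (s + t) / 2) / (t - s) = 1 / 2 by field_simp; ring]; norm_num
  have e2 : |((s : ℝ) - (s + t) / 2) / (t - s)| = 1 / 2 := by
    rw [show ((s : ℝ) - (s + t) / 2) / (t - s) = -(1 / 2) by field_simp; ring]; norm_num
  rw [e1, e2, show ((s : ℝ) + t) / 2 - s = (t - s) / 2 by ring,
    show (t : ℝ) - (s + t) / 2 = (t - s) / 2 by ring]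
  field_simp
  ring

end Paths

/-! ### Measurable Wiener functionals on path space. -/

lemma measurable_stieltjesSum_extendPath (F : ℝ → ℝ) (a b : ℝ) (n : ℕ) :
    Measurable fun w : ℝ≥0 → ℝ => stieltjesSum F a b n (extendPath w) := by
  unfold stieltjesSum extendPath
  fun_prop

/-- A measurable version, on the space of all paths, of the Wiener integral over `[a, b]`. -/
noncomputable def pathWienerIntegral (F : ℝ → ℝ) (a b : ℝ) (w : ℝ≥0 → ℝ) : ℝ :=
  Filter.limUnder Filter.atTop fun n => stieltjesSum F a b n (extendPath w)

/-- Each sum uses finitely many evaluations, hence is measurable for the product σ-algebra;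
`limUnder` stays measurable even on paths where the sums diverge. -/
lemma measurable_pathWienerIntegral (F : ℝ → ℝ) (a b : ℝ) :
    Measurable (pathWienerIntegral F a b) :=
  (StronglyMeasurable.limUnder fun n =>
    (measurable_stieltjesSum_extendPath F a b n).stronglyMeasurable).measurable

lemma pathWienerIntegral_eq {a b : ℝ} (hab : a ≤ b) {F f : ℝ → ℝ} {w : ℝ≥0 → ℝ}
    (hf : IntervalIntegrable f volume a b) (hw : Continuous w)
    (hF : ∀ x y, a ≤ x → x ≤ y → y ≤ b → ∫ r in x..y, f r = F y - F x) :
    pathWienerIntegral F a b w = stieltjesIntegral F f a b (extendPath w) :=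
  (tendsto_stieltjesSum hab hf (continuous_extendPath hw) hF).limUnder_eq

/-! ### Decomposition of the area and independence from the swing. -/

namespace IsStandardBrownianMotion

variable {Ω : Type*} [MeasurableSpace Ω] {P : Measure Ω} {d : ℕ}
  {W : ℝ≥0 → Ω → EuclideanSpace ℝ (Fin d)} {s t : ℝ≥0}

/-- The swing variable `H_{s,u} - H_{u,t}` of the `i`-th coordinate, as a Wiener integral. -/
noncomputable def swingPart (W : ℝ≥0 → Ω → EuclideanSpace ℝ (Fin d)) (s t : ℝ≥0) (i : Fin d)
    (ω : Ω) : ℝ :=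
  stieltjesIntegral (swingKernel s t) (swingDensity s t) s t (extendPath fun q => W q ω i)

/-- The part of the space-time-time area of the `i`-th coordinate which is uncorrelated with
the swing variable. -/
noncomputable def residualPart (W : ℝ≥0 → Ω → EuclideanSpace ℝ (Fin d)) (s t : ℝ≥0) (i : Fin d)
    (ω : Ω) : ℝ :=
  stieltjesIntegral (residualKernel s t) (residualDensity s t) s t (extendPath fun q => W q ω i)

lemma ae_continuous (hW : IsStandardBrownianMotion W P) :
    ∀ᵐ ω ∂P, ∀ i, Continuous fun q => W q ω i :=
  ae_all_iff.2 fun i => (hW.isBrownianReal i).cont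

lemma spaceTimeTimeArea_ae_eq (hW : IsStandardBrownianMotion W P) (hst : s < t) (i : Fin d) :
    (fun ω => spaceTimeTimeArea W s t ω i)
      =ᵐ[P] fun ω => residualPart W s t i ω + 1 / 8 * swingPart W s t i ω := by
  filter_upwards [hW.ae_continuous] with ω hω
  have h := stieltjesIntegral_linear (F := timeTimeKernel s t) (f := timeTimeDensity s t)
    (G := swingKernel s t) (g := swingDensity s t) (continuous_extendPath (hω i))
    ((continuous_timeTimeDensity s t).intervalIntegrable (s : ℝ) t)
    (intervalIntegrable_swingDensity (by exact_mod_cast hst) s t) 1 (-(1 / 8))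
  rw [spaceTimeTimeArea_apply hω hst, residualPart, swingPart]
  change _ = stieltjesIntegral (fun r => 1 * timeTimeKernel s t r + -(1 / 8) * swingKernel s t r)
    (fun r => 1 * timeTimeDensity s t r + -(1 / 8) * swingDensity s t r) _ _ _ + _
  rw [h]
  ring

lemma levySwing_ae_eq (hW : IsStandardBrownianMotion W P) (hst : s < t) :
    levySwing W s t =ᵐ[P] fun ω => WithLp.toLp 2 fun i => Real.sign (swingPart W s t i ω) := by
  filter_upwards [hW.ae_continuous] with ω hω
  simp only [levySwing, swingPart, spaceTimeArea_sub_apply hω hst]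

lemma hasLaw_swingPart (hW : IsStandardBrownianMotion W P) (hst : s < t) (i : Fin d) :
    HasLaw (swingPart W s t i) (gaussianReal 0 (((t : ℝ) - s) / 12).toNNReal) P := by
  have hst' : (s : ℝ) < t := hst
  rw [← integral_swingKernel_sq hst']
  exact (hW.isBrownianReal i).hasLaw_stieltjesIntegral s.2 hst'.le (continuous_swingKernel s t)
    (intervalIntegrable_swingDensity hst' s t) fun x y _ _ _ => integral_swingDensity hst' x y

lemma hasLaw_residualPart (hW : IsStandardBrownianMotion W P) (hst : s < t) (i : Fin d) :
    HasLaw (residualPart W s t i)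
      (gaussianReal 0 ((1 / 720 - 1 / 768) * ((t : ℝ) - s)).toNNReal) P := by
  have hst' : (s : ℝ) < t := hst
  rw [← integral_residualKernel_sq hst']
  exact (hW.isBrownianReal i).hasLaw_stieltjesIntegral s.2 hst'.le (continuous_residualKernel s t)
    (intervalIntegrable_residualDensity hst' s t)
    fun x y _ _ _ => integral_residualDensity hst' x y

lemma indepFun_residualPart_swingPart (hW : IsStandardBrownianMotion W P) (hst : s < t)
    (i : Fin d) : IndepFun (residualPart W s t i) (swingPart W s t i) P := by
  have hst' : (s : ℝ) < t := hst
  exact (hW.isBrownianReal i).indepFun_stieltjesIntegral s.2 hst'.le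
    (continuous_residualKernel s t) (continuous_swingKernel s t)
    (intervalIntegrable_residualDensity hst' s t) (intervalIntegrable_swingDensity hst' s t)
    (fun x y _ _ _ => integral_residualDensity hst' x y)
    (fun x y _ _ _ => integral_swingDensity hst' x y)
    (integral_residualKernel_mul_swingKernel hst')

/-- Independence of the coordinate paths passes to measurable functionals of them;
`pathWienerIntegral` provides these and agrees with the parts on continuous paths. -/
lemma iIndepFun_parts (hW : IsStandardBrownianMotion W P) (hst : s < t) :
    iIndepFun (fun (i : Fin d) ω => (residualPart W s t i ω, swingPart W s t i ω)) P := by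
  have hst' : (s : ℝ) < t := hst
  have h := hW.iIndepFun_coord.comp
    (fun _ w => (pathWienerIntegral (residualKernel s t) s t w,
      pathWienerIntegral (swingKernel s t) s t w))
    (fun _ => (measurable_pathWienerIntegral _ _ _).prodMk (measurable_pathWienerIntegral _ _ _))
  refine h.congr fun i => ?_
  filter_upwards [hW.ae_continuous] with ω hω
  simp only [Function.comp_apply, residualPart, swingPart]
  rw [pathWienerIntegral_eq hst'.le (intervalIntegrable_residualDensity hst' s t) (hω i)
      (fun x y _ _ _ => integral_residualDensity hst' x y),
    pathWienerIntegral_eq hst'.le (intervalIntegrable_swingDensity hst' s t) (hω i)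
      (fun x y _ _ _ => integral_swingDensity hst' x y)]

/-- The residual part and the modulus of the swing variable of one coordinate are jointly
independent of the signs of all the coordinates. -/
lemma indepFun_residualPart_abs_swingPart_levySwing [IsProbabilityMeasure P]
    (hW : IsStandardBrownianMotion W P) (hst : s < t) (i : Fin d) :
    IndepFun (fun ω => (residualPart W s t i ω, |swingPart W s t i ω|)) (levySwing W s t) P := by
  have hv : (((t : ℝ) - s) / 12).toNNReal ≠ 0 := by
    have hst' : (s : ℝ) < t := hst
    rw [Ne, Real.toNNReal_eq_zero, not_le]
    linarith
  have hRm : ∀ j, AEMeasurable (residualPart W s t j) P :=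
    fun j => (hW.hasLaw_residualPart hst j).aemeasurable
  have hDm : ∀ j, AEMeasurable (swingPart W s t j) P :=
    fun j => (hW.hasLaw_swingPart hst j).aemeasurable
  have hZm : ∀ j, AEMeasurable (fun ω => Real.sign (swingPart W s t j ω)) P :=
    fun j => Real.measurable_sign.comp_aemeasurable (hDm j)
  have hRi := hRm i
  have hDi := hDm i
  have hZi := hZm i
  let T : Finset (Fin d) := Finset.univ.erase i
  -- Start from sgn D independent of |D|, then adjoin R, which is independent of the pair (sgn D,
  -- |D|).
  have hZU : IndepFun (fun ω => Real.sign (swingPart W s t i ω))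
      (fun ω => (|swingPart W s t i ω|, residualPart W s t i ω)) P := by
    refine IndepFun.prodMk_right_of_prodMk_left hZi (by fun_prop) hRi
      ((hW.hasLaw_swingPart hst i).indepFun_abs_sign hv).symm ?_
    exact (hW.indepFun_residualPart_swingPart hst i).symm.comp
      (φ := fun x => (Real.sign x, |x|)) (ψ := id)
      (Real.measurable_sign.prodMk measurable_abs) measurable_id
  have hUZ : IndepFun (fun ω => (residualPart W s t i ω, |swingPart W s t i ω|))
      (fun ω => Real.sign (swingPart W s t i ω)) P :=
    hZU.symm.comp (φ := Prod.swap) (ψ := id) measurable_swap measurable_id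
  -- Everything built from coordinate `i` is independent of the signs of all other coordinates.
  have hUZY : IndepFun
      (fun ω => ((residualPart W s t i ω, |swingPart W s t i ω|),
        Real.sign (swingPart W s t i ω)))
      (fun ω (j : T) => Real.sign (swingPart W s t j ω)) P := by
    have h := (hW.iIndepFun_parts hst).indepFun_finset₀ {i} T (by simp [T])
      (fun j => (hRm j).prodMk (hDm j))
    let φ : (({i} : Finset (Fin d)) → ℝ × ℝ) → (ℝ × ℝ) × ℝ := fun p =>
      (((p ⟨i, by simp⟩).1, |(p ⟨i, by simp⟩).2|), Real.sign (p ⟨i, by simp⟩).2)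
    have hφ : Measurable φ :=
      Measurable.prodMk (by fun_prop) (Real.measurable_sign.comp (by fun_prop))
    let ψ : (T → ℝ × ℝ) → T → ℝ := fun p j => Real.sign (p j).2
    have hψ : Measurable ψ :=
      measurable_pi_lambda _ fun j => Real.measurable_sign.comp (by fun_prop)
    exact h.comp hφ hψ
  have hYm : AEMeasurable (fun ω (j : T) => Real.sign (swingPart W s t j ω)) P :=
    aemeasurable_pi_lambda _ fun j => hZm j
  have hU := IndepFun.prodMk_right_of_prodMk_left (by fun_prop) hZi hYm hUZ hUZY
  -- Reassembles the swing vector from the `i`-th sign and the remaining ones.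
  let Φ : ℝ × (T → ℝ) → EuclideanSpace ℝ (Fin d) := fun p =>
    WithLp.toLp 2 fun j => if h : j = i then p.1 else p.2 ⟨j, by simp [T, h]⟩
  have hΦ : Measurable Φ := by
    refine (WithLp.measurable_toLp 2 _).comp (measurable_pi_lambda _ fun j => ?_)
    by_cases h : j = i
    · simp only [h, dite_true]
      fun_prop
    · simp only [h, dite_false]
      fun_prop
  refine (hU.comp measurable_id hΦ).congr Filter.EventuallyEq.rfl ?_
  filter_upwards [hW.levySwing_ae_eq hst] with ω hω
  rw [hω]
  simp only [Function.comp_apply, Φ]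
  congr 1
  ext j
  by_cases h : j = i
  · subst h; simp
  · simp [h]

end IsStandardBrownianMotion

/-- Paths are continuous only almost surely, so that the swing is defined up to a null set;
conditioning on it means conditioning on the sigma-algebra of a measurable version `n`. Such a
version exists, and the formulas hold for every one of them (for the swing itself as soon as it
is measurable). -/
theorem theorem4p9 {Ω : Type*} [MeasurableSpace Ω] (P : Measure Ω) [IsProbabilityMeasure P]
    {d : ℕ} (W : ℝ≥0 → Ω → EuclideanSpace ℝ (Fin d)) (hW : IsStandardBrownianMotion W P)
    (s t : ℝ≥0) (hst : s < t) :
    MemLp (spaceTimeTimeArea W s t) 2 P ∧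
    AEMeasurable (levySwing W s t) P ∧
    ∀ n : Ω → EuclideanSpace ℝ (Fin d), Measurable n → n =ᵐ[P] levySwing W s t →
      P[spaceTimeTimeArea W s t | MeasurableSpace.comap n inferInstance] =ᵐ[P]
          (fun ω => (1 / (8 * √(6 * Real.pi)) * √((t : ℝ) - s)) • n ω) ∧
      ∀ i : Fin d,
        Var[fun ω => spaceTimeTimeArea W s t ω i; P | MeasurableSpace.comap n inferInstance]
          =ᵐ[P] fun _ => (1 / 720 - 1 / (384 * Real.pi)) * ((t : ℝ) - s) := by
  have hst' : (s : ℝ) < t := hst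
  have hpos : 0 < (t : ℝ) - s := by linarith
  have hR := hW.hasLaw_residualPart hst
  have hD := hW.hasLaw_swingPart hst
  have hK : MemLp (spaceTimeTimeArea W s t) 2 P := by
    refine MemLp.of_eval_piLp fun i => ?_
    exact (memLp_congr_ae (hW.spaceTimeTimeArea_ae_eq hst i)).2
      ((hR i).hasGaussianLaw.memLp_two.add ((hD i).hasGaussianLaw.memLp_two.const_mul (1 / 8)))
  refine ⟨hK, ?_, fun n hn hnW => ?_⟩
  · refine AEMeasurable.congr ?_ (hW.levySwing_ae_eq hst).symm
    exact (WithLp.measurable_toLp 2 _).comp_aemeasurable (aemeasurable_pi_lambda _ fun i =>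
      Real.measurable_sign.comp_aemeasurable (hD i).aemeasurable)
  have hvD : (((t : ℝ) - s) / 12).toNNReal ≠ 0 := by
    rw [Ne, Real.toNNReal_eq_zero, not_le]
    positivity
  have key := fun i => condExp_condVar_add_mul_of_sign (1 / 8) hvD hn (hR i) (hD i)
    (hW.indepFun_residualPart_swingPart hst i)
    ((hW.indepFun_residualPart_abs_swingPart_levySwing hst i).congr Filter.EventuallyEq.rfl
      hnW.symm)
    (ν := fun ω => n ω i)
    ((by fun_prop : Measurable fun x : EuclideanSpace ℝ (Fin d) => x i).comp
      (comap_measurable n))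
    (by
      filter_upwards [hnW, hW.levySwing_ae_eq hst] with ω h1 h2
      rw [h1, h2])
  simp only [Real.coe_toNNReal _ (by positivity : 0 ≤ ((t : ℝ) - s) / 12),
    Real.coe_toNNReal _ (by linarith : 0 ≤ (1 / 720 - 1 / 768) * ((t : ℝ) - s))] at key
  constructor
  · have hc : 1 / 8 * √(2 * (((t : ℝ) - s) / 12) / Real.pi)
        = 1 / (8 * √(6 * Real.pi)) * √((t : ℝ) - s) := by
      rw [show 2 * (((t : ℝ) - s) / 12) / Real.pi = ((t : ℝ) - s) / (6 * Real.pi) by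
        field_simp; norm_num, Real.sqrt_div' _ (by positivity)]
      field_simp
    have hcoord : ∀ᵐ ω ∂P, ∀ i,
        P[spaceTimeTimeArea W s t | MeasurableSpace.comap n inferInstance] ω i
          = 1 / (8 * √(6 * Real.pi)) * √((t : ℝ) - s) * n ω i := by
      refine ae_all_iff.2 fun i => ?_
      -- Conditional expectation commutes with continuous linear maps, so the vector identity
      -- reduces to coordinates.
      have h := (EuclideanSpace.proj (𝕜 := ℝ) i).comp_condExp_comm
        (m := MeasurableSpace.comap n inferInstance) (hK.integrable (by norm_num))
      filter_upwards [h, condExp_congr_ae (m := MeasurableSpace.comap n inferInstance)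
        (hW.spaceTimeTimeArea_ae_eq hst i), (key i).1] with ω h1 h2 h3
      rw [← hc, ← h3, ← h2]
      exact h1
    filter_upwards [hcoord] with ω hω
    ext i
    rw [hω i, PiLp.smul_apply, smul_eq_mul]
  · intro i
    filter_upwards [condVar_congr_ae (m := MeasurableSpace.comap n inferInstance)
      (hW.spaceTimeTimeArea_ae_eq hst i), (key i).2] with ω h1 h2
    rw [h1, h2]
    field_simp
    ring
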